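/- Let $n\ge 0$, let $R=\mathbb{C}[x_1,\dots,x_n]$ with $S_n$ permuting the variables, and let $\ell(w)$ be the Bruhat (Coxeter) length of $w\in S_n$ with respect to the simple reflections $(j\ j{+}1)$. For $w\in S_n$ put $$\Delta_w=\prod_{i<j,\ w(i)>w(j)}(x_i-x_j).$$ Let $R_w$ be the $R$-bimodule (that is, $R\otimes_{\mathbb C}R$-module) with underlying space $R$ and action $(f\otimes g)\cdot h=g(x_{w(1)},\dots,x_{w(n)})\,f\,h$, and let $$F_w\colon R\otimes_{R^{S_n}}R\to R_w,\qquad f\otimes g\mapsto g(x_{w(1)},\dots,x_{w(n)})\,f,$$ which is a homomorphism of $R$-bimodules. Write $R_w\cdot\Delta_w\subset R_w$ for the sub-bimodule of right multiples of $\Delta_w$, i.e. $\{\Delta_w(x_{w(1)},\dots,x_{w(n)})\,h : h\in R\}$ (as a subset of $R$ it is the ideal generated by $\Delta_{w^{-1}}$), and $\Delta_w\cdot R_w$ for the sub-bimodule of left multiples. Then the $R$-bimodule $R\otimes_{R^{S_n}}R$ admits a filtration by sub-bimodules $$0=\Gamma_{\binom n2+1}\subset\Gamma_{\binom n2}\subset\cdots\subset\Gamma_1\subset\Gamma_0=R\otimes_{R^{S_n}}R$$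 such that for every $0\le j\le\binom n2$ the maps $F_w$ with $\ell(w)=j$ induce an isomorphism of $R$-bimodules $$\bigoplus_{\ell(w)=j}F_w\colon\ \Gamma_j/\Gamma_{j+1}\xrightarrow{\ \sim\ }\bigoplus_{\ell(w)=j}R_w\cdot\Delta_w .$$ In particular $\Gamma_j/\Gamma_{j+1}$ is also isomorphic, as an $R$-bimodule, to $\bigoplus_{\ell(w)=j}\Delta_w\cdot R_w$. -/

import Mathlib

open scoped TensorProduct DirectSum

noncomputable section

namespace GammaFiltration

/-- `R = ℂ[x₁, …, xₙ]`. -/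
abbrev R (n : ℕ) : Type := MvPolynomial (Fin n) ℂ

/-- `R^{Sₙ}`, the subalgebra of symmetric polynomials. -/
abbrev RSym (n : ℕ) : Subalgebra ℂ (R n) := MvPolynomial.symmetricSubalgebra (Fin n) ℂ

/-- The enveloping algebra `R ⊗_ℂ R`. An `R`-bimodule (over `ℂ`) is a module over it: `f ⊗ g` acts
by `f` from the left and by `g` from the right. -/
def Env (n : ℕ) : Type := R n ⊗[ℂ] R n

instance instCommRingEnv (n : ℕ) : CommRing (Env n) :=
  inferInstanceAs (CommRing (R n ⊗[ℂ] R n))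

/-- The element `f ⊗ g` of `R ⊗_ℂ R`. -/
def Env.tmul {n : ℕ} (f g : R n) : Env n := f ⊗ₜ[ℂ] g

/-- `R ⊗_{R^{Sₙ}} R`. -/
def T (n : ℕ) : Type := R n ⊗[RSym n] R n

instance instCommRingT (n : ℕ) : CommRing (T n) :=
  inferInstanceAs (CommRing (R n ⊗[RSym n] R n))

/-- The element `f ⊗ g` of `R ⊗_{R^{Sₙ}} R`. -/
def T.tmul {n : ℕ} (f g : R n) : T n := f ⊗ₜ[RSym n] g

/-- The simple reflections `(j j+1)` of `Sₙ`. -/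
def IsSimpleReflection {n : ℕ} (s : Equiv.Perm (Fin n)) : Prop :=
  ∃ i j : Fin n, (i : ℕ) + 1 = (j : ℕ) ∧ s = Equiv.swap i j

/-- The Bruhat (Coxeter) length: the least length of a word in simple reflections with product
`w`. -/
def length {n : ℕ} (w : Equiv.Perm (Fin n)) : ℕ :=
  sInf {k | ∃ l : List (Equiv.Perm (Fin n)),
    (∀ s ∈ l, IsSimpleReflection s) ∧ l.prod = w ∧ l.length = k}

/-- The inversions `(i, j)`, `i < j`, `w i > w j`. -/
def inv {n : ℕ} (w : Equiv.Perm (Fin n)) : Finset (Fin n × Fin n) :=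
  Finset.univ.filter fun p => p.1 < p.2 ∧ w p.2 < w p.1

/-- `Δ_w = ∏_{(i,j) ∈ inv w} (x_i - x_j)`. -/
def Delta {n : ℕ} (w : Equiv.Perm (Fin n)) : R n :=
  ∏ p ∈ inv w, (MvPolynomial.X p.1 - MvPolynomial.X p.2)

/-- The algebra map `R ⊗_ℂ R → R ⊗_{R^{Sₙ}} R`, `f ⊗ g ↦ f ⊗ g`. -/
def envToT (n : ℕ) : Env n →+* T n :=
  (Algebra.TensorProduct.lift
    (Algebra.TensorProduct.includeLeft : R n →ₐ[ℂ] R n ⊗[RSym n] R n)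
    ((Algebra.TensorProduct.includeRight :
      R n →ₐ[RSym n] R n ⊗[RSym n] R n).restrictScalars ℂ)
    (fun _ _ => Commute.all _ _) : R n ⊗[ℂ] R n →ₐ[ℂ] R n ⊗[RSym n] R n).toRingHom

/-- The bimodule structure on `R ⊗_{R^{Sₙ}} R`: `(f ⊗ g) • (a ⊗ b) = f a ⊗ g b`. -/
instance instModuleT (n : ℕ) : Module (Env n) (T n) :=
  Module.compHom (T n) (envToT n)

/-- The algebra map `R ⊗_ℂ R → R`, `f ⊗ g ↦ f · g(x_{w(1)}, …, x_{w(n)})`. -/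
def envToR {n : ℕ} (w : Equiv.Perm (Fin n)) : Env n →+* R n :=
  (Algebra.TensorProduct.lift (AlgHom.id ℂ (R n)) (MvPolynomial.rename w)
    (fun _ _ => Commute.all _ _) : R n ⊗[ℂ] R n →ₐ[ℂ] R n).toRingHom

/-- The underlying additive group of the bimodule `R_w`, which is that of `R`. -/
def RTw {n : ℕ} (_w : Equiv.Perm (Fin n)) : Type := R n

instance instAddCommGroupRTw {n : ℕ} (w : Equiv.Perm (Fin n)) : AddCommGroup (RTw w) :=
  inferInstanceAs (AddCommGroup (R n))

/-- The twisted bimodule structure of `R_w`: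
`(f ⊗ g) • h = g(x_{w(1)}, …, x_{w(n)}) f h`. -/
instance instModuleRTw {n : ℕ} (w : Equiv.Perm (Fin n)) : Module (Env n) (RTw w) :=
  Module.compHom (R n) (envToR w)

/-- `g ↦ g(x_{w(1)}, …, x_{w(n)})` as a map of `R^{Sₙ}`-algebras. -/
def renameSym {n : ℕ} (w : Equiv.Perm (Fin n)) : R n →ₐ[RSym n] R n :=
  { (MvPolynomial.rename w : R n →ₐ[ℂ] R n).toRingHom with
    commutes' := fun r => r.2 w }

/-- `R ⊗_{R^{Sₙ}} R → R`, `f ⊗ g ↦ f · g(x_{w(1)}, …, x_{w(n)})`. -/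
def FAlg {n : ℕ} (w : Equiv.Perm (Fin n)) : T n →+* R n :=
  (Algebra.TensorProduct.lift (AlgHom.id (RSym n) (R n)) (renameSym w)
    (fun _ _ => Commute.all _ _) : R n ⊗[RSym n] R n →ₐ[RSym n] R n).toRingHom

theorem envToT_tmul {n : ℕ} (f g : R n) : envToT n (Env.tmul f g) = T.tmul f g := by
  change (f ⊗ₜ[RSym n] (1 : R n)) * ((1 : R n) ⊗ₜ[RSym n] g) = f ⊗ₜ[RSym n] g
  rw [Algebra.TensorProduct.tmul_mul_tmul, mul_one, one_mul]

theorem envToR_tmul {n : ℕ} (w : Equiv.Perm (Fin n)) (f g : R n) :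
    envToR w (Env.tmul f g) = f * MvPolynomial.rename w g :=
  rfl

theorem FAlg_tmul {n : ℕ} (w : Equiv.Perm (Fin n)) (f g : R n) :
    FAlg w (T.tmul f g) = f * MvPolynomial.rename w g :=
  rfl

theorem FAlg_envToT {n : ℕ} (w : Equiv.Perm (Fin n)) (a : Env n) :
    FAlg w (envToT n a) = envToR w a := by
  refine TensorProduct.induction_on (motive := fun a : R n ⊗[ℂ] R n =>
    FAlg w (envToT n a) = envToR w a) a ?_ ?_ ?_
  · exact (congrArg (FAlg w) (map_zero (envToT n))).trans
      ((map_zero (FAlg w)).trans (map_zero (envToR w)).symm)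
  · intro f g
    exact (congrArg (FAlg w) (envToT_tmul f g)).trans
      ((FAlg_tmul w f g).trans (envToR_tmul w f g).symm)
  · intro a b ha hb
    have h1 := map_add (envToT n) a b
    have h2 := map_add (envToR w) a b
    exact (congrArg (FAlg w) h1).trans ((map_add (FAlg w) _ _).trans
      ((congrArg₂ (· + ·) ha hb).trans h2.symm))

/-- The bimodule homomorphism `F_w : R ⊗_{R^{Sₙ}} R → R_w`,
`f ⊗ g ↦ g(x_{w(1)}, …, x_{w(n)}) f`. -/
def F {n : ℕ} (w : Equiv.Perm (Fin n)) : T n →ₗ[Env n] RTw w where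
  toFun := fun t => (FAlg w t : R n)
  map_add' := fun s t => map_add (FAlg w) s t
  map_smul' := fun a t => by
    change FAlg w (envToT n a * t) = envToR w a * FAlg w t
    rw [map_mul, FAlg_envToT]

/-- The sub-bimodule `f · R_w`: the multiples of `f`, acting from the left. -/
def leftMul {n : ℕ} (w : Equiv.Perm (Fin n)) (f : R n) : Submodule (Env n) (RTw w) :=
  LinearMap.range (LinearMap.lsmul (Env n) (RTw w) (Env.tmul f 1))

/-- The sub-bimodule `R_w · g`: the multiples of `g`, acting from the right. -/
def rightMul {n : ℕ} (w : Equiv.Perm (Fin n)) (g : R n) : Submodule (Env n) (RTw w) :=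
  LinearMap.range (LinearMap.lsmul (Env n) (RTw w) (Env.tmul 1 g))

/-- The successive quotient `A / B` of sub-bimodules `B ⊆ A` of `R ⊗_{R^{Sₙ}} R`. -/
abbrev Gr {n : ℕ} (A B : Submodule (Env n) (T n)) : Type :=
  A ⧸ B.submoduleOf A

end GammaFiltration

end

namespace GammaFiltration

open MvPolynomial Equiv

noncomputable section

/-! ### Words in the simple reflections and inversions -/

/-! Take Γ_j to be the common kernel of the F_v with ℓ(v) < j. On Γ_j the joint kernel of the F_w
with ℓ(w) = j is Γ_{j+1}, so three facts remain.

Image: F_w ≡ F_{(a b)w} modulo x_a - x_b. If (p, q) is an inversion of w, then w·(p q) is shorter,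
so x_{w p} - x_{w q} divides F_w t for t in Γ_{ℓ(w)}. These factors are pairwise coprime, hence
their product divides F_w t (`rename_Delta_dvd_FAlg`).

Surjectivity: starting from `topElement` at the longest element w₀, divided differences in the right
tensor factor give, by descending induction, t_w with F_w t_w = w(Δ_w) and F_v t_w = 0 for all other
v with ℓ(v) ≤ ℓ(w) (`exists_FAlg_eq_rename_Delta`).

Vanishing of the last step: the F_w are jointly injective. Write `topElement` = ∑ a_l ⊗ b_l and let
D be antisymmetrization divided by the Vandermonde product. Then R is spanned over R^{Sₙ} by
explicit c_l with coefficients h ↦ D(b_l h). Expanding the right factor of t this way gives left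
coefficients that, times the Vandermonde product, are combinations of the F_w t
(`eq_zero_of_forall_FAlg_eq_zero`). -/

theorem swap_lt_swap_of_succ {n : ℕ} {i j p q : Fin n} (hij : (i : ℕ) + 1 = j) (hpq : p < q)
    (hne : (p, q) ≠ (i, j)) : swap i j p < swap i j q := by
  have hne' : ¬ (p = i ∧ q = j) := fun h => hne (Prod.ext h.1 h.2)
  rw [swap_apply_def, swap_apply_def]
  simp only [Fin.lt_def, Fin.ext_iff] at *
  split_ifs <;> omega

/-- The strong exchange property: multiplying a word by the transposition of an inversion
shortens it. -/
theorem exists_shorter_word {n : ℕ} (l : List (Perm (Fin n)))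
    (hl : ∀ s ∈ l, IsSimpleReflection s) (p q : Fin n) (hpq : p < q)
    (hinv : l.prod q < l.prod p) :
    ∃ l' : List (Perm (Fin n)), (∀ s ∈ l', IsSimpleReflection s) ∧
      l'.prod = l.prod * swap p q ∧ l'.length < l.length := by
  induction l using List.reverseRecOn generalizing p q with
  | nil => exact absurd hinv (by simpa using hpq.le)
  | append_singleton l s ih =>
    have hl' : ∀ t ∈ l, IsSimpleReflection t := fun t ht => hl t (by simp [ht])
    have hs : IsSimpleReflection s := hl s (by simp)
    obtain ⟨i, j, hij, rfl⟩ := hs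
    by_cases h : (p, q) = (i, j)
    · obtain ⟨rfl, rfl⟩ := Prod.mk.inj h
      exact ⟨l, hl', by simp [mul_assoc], by simp⟩
    -- With s = (i j), the pair (s p, s q) is an inversion of the prefix, and (s p s q)·s = s·(p q).
    · obtain ⟨l', h1, h2, h3⟩ := ih hl' _ _ (swap_lt_swap_of_succ hij hpq h)
        (by simpa using hinv)
      refine ⟨l' ++ [swap i j], ?_, ?_, by simpa using h3⟩
      · intro t ht
        rcases List.mem_append.1 ht with ht | ht
        · exact h1 t ht
        · exact ⟨i, j, hij, by simpa using ht⟩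
      · rw [List.prod_append, h2, List.prod_append, List.prod_singleton, swap_apply_apply]
        simp [mul_assoc]

theorem mem_inv {n : ℕ} {w : Perm (Fin n)} {p : Fin n × Fin n} :
    p ∈ inv w ↔ p.1 < p.2 ∧ w p.2 < w p.1 := by
  simp [inv]

theorem inv_eq_insert {n : ℕ} {w : Perm (Fin n)} {i j : Fin n} (hij : (i : ℕ) + 1 = j)
    (hw : w j < w i) :
    inv w = insert (i, j)
      ((inv (w * swap i j)).map ((swap i j).prodCongr (swap i j)).toEmbedding) := by
  ext ⟨a, b⟩
  simp only [Finset.mem_insert, Finset.mem_map_equiv, mem_inv, prodCongr_symm, prodCongr_apply,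
    Prod.map_apply, symm_swap, Perm.coe_mul, Function.comp_apply, swap_apply_self]
  constructor
  · rintro ⟨h1, h2⟩
    by_cases h : (a, b) = (i, j)
    · exact Or.inl h
    · exact Or.inr ⟨swap_lt_swap_of_succ hij h1 h, h2⟩
  · rintro (h | ⟨h1, h2⟩)
    · obtain ⟨rfl, rfl⟩ := Prod.mk.inj h
      exact ⟨by rw [Fin.lt_def]; omega, hw⟩
    · refine ⟨?_, h2⟩
      -- The only pair whose order could flip is (s a, s b) = (i, j), which `h2` excludes.
      have := swap_lt_swap_of_succ hij h1 (fun h => ?_)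
      · simpa using this
      · obtain ⟨ha, hb⟩ := Prod.mk.inj h
        have ha' : a = j := by rw [← swap_apply_self i j a, ha, swap_apply_left]
        have hb' : b = i := by rw [← swap_apply_self i j b, hb, swap_apply_right]
        subst ha' hb'
        exact absurd h2 hw.le.not_gt

theorem notMem_map_inv {n : ℕ} (w : Perm (Fin n)) {i j : Fin n} (hij : (i : ℕ) + 1 = j) :
    (i, j) ∉ (inv (w * swap i j)).map ((swap i j).prodCongr (swap i j)).toEmbedding := by
  simp only [Finset.mem_map_equiv, mem_inv, prodCongr_symm, prodCongr_apply,
    Prod.map_apply, symm_swap, swap_apply_left, swap_apply_right, not_and]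
  intro h
  rw [Fin.lt_def] at h
  omega

theorem eq_one_of_forall_succ_lt {n : ℕ} (w : Perm (Fin n))
    (h : ∀ i j : Fin n, (i : ℕ) + 1 = j → w i < w j) : w = 1 := by
  have hm : StrictMono w := by
    cases n with
    | zero => exact fun a => a.elim0
    | succ n => exact Fin.strictMono_iff_lt_succ.2 fun i => h _ _ (by simp)
  have := Subsingleton.elim (StrictMono.orderIsoOfSurjective w hm w.surjective)
    (OrderIso.refl _)
  ext i
  exact congrArg (fun e : Fin n ≃o Fin n => (e i : ℕ)) this

theorem exists_succ_lt_of_ne_one {n : ℕ} {w : Perm (Fin n)} (hw : w ≠ 1) :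
    ∃ i j : Fin n, (i : ℕ) + 1 = j ∧ w j < w i := by
  by_contra! h
  refine hw (eq_one_of_forall_succ_lt w fun i j hij => lt_of_le_of_ne (h i j hij) fun e => ?_)
  have := congrArg Fin.val (w.injective e)
  omega

theorem exists_lt_succ_of_ne_rev {n : ℕ} {w : Perm (Fin n)} (hw : w ≠ Fin.revPerm) :
    ∃ i j : Fin n, (i : ℕ) + 1 = j ∧ w i < w j := by
  obtain ⟨i, j, hij, h⟩ := exists_succ_lt_of_ne_one (w := Fin.revPerm * w) (fun h => hw (by
    rw [← mul_left_cancel_iff (a := Fin.revPerm), h]; ext; simp))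
  exact ⟨i, j, hij, by simpa using h⟩

theorem card_inv_eq {n : ℕ} {w : Perm (Fin n)} {i j : Fin n} (hij : (i : ℕ) + 1 = j)
    (hw : w j < w i) : (inv w).card = (inv (w * swap i j)).card + 1 := by
  rw [inv_eq_insert hij hw, Finset.card_insert_of_notMem (notMem_map_inv w hij), Finset.card_map]

/-- Each descent removed costs one inversion. This bounds `length` by the number of inversions, and
shows that its infimum is over a nonempty set, not the default value 0. -/
theorem exists_word_length_eq_card_inv {n : ℕ} (w : Perm (Fin n)) :
    ∃ l : List (Perm (Fin n)), (∀ s ∈ l, IsSimpleReflection s) ∧ l.prod = w ∧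
      l.length = (inv w).card := by
  induction h : (inv w).card generalizing w with
  | zero =>
    refine ⟨[], by simp, ?_, rfl⟩
    by_contra hw
    obtain ⟨i, j, hij, hlt⟩ := exists_succ_lt_of_ne_one (Ne.symm hw)
    have := card_inv_eq hij hlt
    omega
  | succ k ih =>
    have hw : w ≠ 1 := by
      rintro rfl
      obtain ⟨p, hp⟩ := Finset.card_pos.1 (by omega : 0 < (inv (1 : Perm (Fin n))).card)
      rw [mem_inv] at hp
      exact lt_asymm hp.1 hp.2
    obtain ⟨i, j, hij, hlt⟩ := exists_succ_lt_of_ne_one hw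
    obtain ⟨l, h1, h2, h3⟩ := ih (w * swap i j) (by have := card_inv_eq hij hlt; omega)
    refine ⟨l ++ [swap i j], ?_, by simp [h2, mul_assoc], by simp [h3]⟩
    intro t ht
    rcases List.mem_append.1 ht with ht | ht
    · exact h1 t ht
    · exact ⟨i, j, hij, by simpa using ht⟩

theorem length_le_of_word {n : ℕ} (l : List (Perm (Fin n)))
    (hl : ∀ s ∈ l, IsSimpleReflection s) : length l.prod ≤ l.length :=
  Nat.sInf_le ⟨l, hl, rfl, rfl⟩

theorem exists_reduced_word {n : ℕ} (w : Perm (Fin n)) :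
    ∃ l : List (Perm (Fin n)), (∀ s ∈ l, IsSimpleReflection s) ∧ l.prod = w ∧
      l.length = length w := by
  obtain ⟨l, h1, h2, h3⟩ := exists_word_length_eq_card_inv w
  exact Nat.sInf_mem (s := {k | ∃ l : List (Perm (Fin n)),
    (∀ s ∈ l, IsSimpleReflection s) ∧ l.prod = w ∧ l.length = k}) ⟨_, l, h1, h2, h3⟩

theorem card_filter_fst_lt_snd (n : ℕ) :
    (Finset.univ.filter fun p : Fin n × Fin n => p.1 < p.2).card = n.choose 2 := by
  rw [Finset.card_filter, Fintype.sum_prod_type_right]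
  simp_rw [← Finset.card_filter]
  have (j : Fin n) : (Finset.univ.filter fun i : Fin n => i < j).card = j := by
    rw [Finset.filter_gt_eq_Iio, Fin.card_Iio]
  simp_rw [this]
  rw [Fin.sum_univ_eq_sum_range (fun i => i), Finset.sum_range_id, Nat.choose_two_right]

theorem length_le_choose {n : ℕ} (w : Perm (Fin n)) : length w ≤ n.choose 2 := by
  obtain ⟨l, h1, rfl, h3⟩ := exists_word_length_eq_card_inv w
  refine (length_le_of_word l h1).trans (h3.trans_le ?_)
  rw [← card_filter_fst_lt_snd]
  exact Finset.card_le_card fun p hp => by simpa using (mem_inv.1 hp).1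

theorem length_mul_swap_lt {n : ℕ} {w : Perm (Fin n)} {p q : Fin n} (hpq : p < q)
    (hw : w q < w p) : length (w * swap p q) < length w := by
  obtain ⟨l, h1, rfl, h3⟩ := exists_reduced_word w
  obtain ⟨l', h1', h2', h3'⟩ := exists_shorter_word l h1 p q hpq hw
  rw [← h3, ← h2']
  exact (length_le_of_word l' h1').trans_lt h3'

theorem length_mul_swap_le {n : ℕ} (w : Perm (Fin n)) {i j : Fin n} (hij : (i : ℕ) + 1 = j) :
    length (w * swap i j) ≤ length w + 1 := by
  obtain ⟨l, h1, rfl, h3⟩ := exists_reduced_word w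
  have := length_le_of_word (l ++ [swap i j]) (fun t ht => by
    rcases List.mem_append.1 ht with ht | ht
    · exact h1 t ht
    · exact ⟨i, j, hij, by simpa using ht⟩)
  simpa [h3] using this

/-! ### Differences of variables -/

theorem X_sub_X_ne_zero {n : ℕ} {i j : Fin n} (hij : i ≠ j) : (X i - X j : R n) ≠ 0 :=
  sub_ne_zero.2 fun h => hij (X_injective h)

theorem irreducible_X_sub_X {n : ℕ} {i j : Fin n} (hij : i ≠ j) :
    Irreducible (X i - X j : R n) := by
  have hc : coeff (Finsupp.single i 1) (X i - X j : R n) = 1 := by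
    have h : Finsupp.single j 1 ≠ Finsupp.single i 1 := fun h =>
      hij (Finsupp.single_left_injective one_ne_zero h).symm
    rw [coeff_sub, coeff_X, coeff_X, if_pos rfl, if_neg h, sub_zero]
  refine irreducible_of_totalDegree_eq_one ?_ ?_
  · refine le_antisymm ?_ ?_
    · exact (totalDegree_sub _ _).trans (by simp [totalDegree_X])
    · refine le_trans ?_ (le_totalDegree (s := Finsupp.single i 1) ?_)
      · simp
      · rw [mem_support_iff, hc]
        exact one_ne_zero
  · intro x hx
    exact isUnit_of_dvd_one (hc ▸ hx _)

/-- At the k-th basis vector the divisor vanishes and x_k - x_l takes the value 1. -/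
theorem not_X_sub_X_dvd {n : ℕ} {i j k l : Fin n} (hkl : k ≠ l) (hi : k ≠ i) (hj : k ≠ j) :
    ¬ (X i - X j : R n) ∣ X k - X l := by
  rintro ⟨c, hc⟩
  have := congrArg (eval (Pi.single k (1 : ℂ))) hc
  simp [hi.symm, hj.symm, hkl.symm] at this

theorem isRelPrime_X_sub_X {n : ℕ} {i j k l : Fin n} (hij : i < j) (hkl : k < l)
    (hne : (i, j) ≠ (k, l)) : IsRelPrime (X i - X j : R n) (X k - X l) := by
  rw [(irreducible_X_sub_X hij.ne).isRelPrime_iff_not_dvd]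
  by_cases hk : k ≠ i ∧ k ≠ j
  · exact not_X_sub_X_dvd hkl.ne hk.1 hk.2
  · have hl : l ≠ i ∧ l ≠ j := by
      have hne' : ¬ (i = k ∧ j = l) := fun h => hne (Prod.ext h.1 h.2)
      simp only [Fin.lt_def, Fin.ext_iff, ne_eq] at *
      omega
    rw [← dvd_neg, neg_sub]
    exact not_X_sub_X_dvd hkl.ne' hl.1 hl.2

theorem prod_X_sub_X_dvd {n : ℕ} (s : Finset (Fin n × Fin n)) (hs : ∀ p ∈ s, p.1 < p.2)
    {f : R n} (hf : ∀ p ∈ s, (X p.1 - X p.2 : R n) ∣ f) :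
    ∏ p ∈ s, (X p.1 - X p.2 : R n) ∣ f :=
  Finset.prod_dvd_of_isRelPrime
    (fun p hp q hq hpq => isRelPrime_X_sub_X (hs p hp) (hs q hq) hpq) hf

/-- Modulo x_i - x_j the swap fixes the class of every variable. -/
theorem X_sub_X_dvd_sub_rename_swap {n : ℕ} (i j : Fin n) (g : R n) :
    (X i - X j : R n) ∣ g - rename (swap i j) g := by
  rw [← Ideal.mem_span_singleton, ← Ideal.Quotient.eq]
  have h : Ideal.Quotient.mkₐ ℂ (Ideal.span {(X i - X j : R n)}) =
      (Ideal.Quotient.mkₐ ℂ (Ideal.span {(X i - X j : R n)})).comp (rename (swap i j)) := by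
    have hX : Ideal.Quotient.mk (Ideal.span {(X i - X j : R n)}) (X i) =
        Ideal.Quotient.mk (Ideal.span {(X i - X j : R n)}) (X j) :=
      Ideal.Quotient.eq.2 (Ideal.mem_span_singleton_self _)
    refine algHom_ext fun k => ?_
    simp only [AlgHom.comp_apply, rename_X, Ideal.Quotient.mkₐ_eq_mk]
    rcases eq_or_ne k i with rfl | hi
    · rw [swap_apply_left, hX]
    · rcases eq_or_ne k j with rfl | hj
      · rw [swap_apply_right, hX]
      · rw [swap_apply_of_ne_of_ne hi hj]
  exact congrArg (fun φ => φ g) h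

/-! ### The maps `F_w` -/

theorem T.induction_on {n : ℕ} {P : T n → Prop} (t : T n)
    (tmul : ∀ f g, P (T.tmul f g)) (add : ∀ s t, P s → P t → P (s + t)) : P t :=
  TensorProduct.induction_on (motive := P) t
    (by
      have h := tmul 0 0
      rwa [show T.tmul (0 : R n) 0 = 0 from TensorProduct.zero_tmul _ _] at h)
    tmul add

theorem T.exists_sum_tmul {n : ℕ} (t : T n) :
    ∃ (k : ℕ) (f g : Fin k → R n), t = ∑ i, T.tmul (f i) (g i) :=
  TensorProduct.exists_sum_tmul_eq (R := RSym n) (M := R n) (N := R n) t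

theorem X_sub_X_dvd_FAlg_sub {n : ℕ} (w : Perm (Fin n)) (a b : Fin n) (t : T n) :
    (X a - X b : R n) ∣ FAlg w t - FAlg (swap a b * w) t := by
  induction t using T.induction_on with
  | tmul f g =>
    rw [FAlg_tmul, FAlg_tmul, Perm.coe_mul, ← rename_rename, ← mul_sub]
    exact (X_sub_X_dvd_sub_rename_swap a b _).mul_left f
  | add s t hs ht =>
    rw [map_add, map_add, add_sub_add_comm]
    exact dvd_add hs ht

/-- The divided difference `(f ⊗ g) ↦ f ⊗ (g - s g) / (x_i - x_j)`, `s = (i j)`, seen through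
the maps `F_v`. -/
theorem exists_divided_difference {n : ℕ} (i j : Fin n) (t : T n) :
    ∃ t' : T n, ∀ v : Perm (Fin n),
      (X (v i) - X (v j)) * FAlg v t' = FAlg v t - FAlg (v * swap i j) t := by
  induction t using T.induction_on with
  | tmul f g =>
    obtain ⟨h, hh⟩ := X_sub_X_dvd_sub_rename_swap i j g
    refine ⟨T.tmul f h, fun v => ?_⟩
    rw [FAlg_tmul, FAlg_tmul, FAlg_tmul, Perm.coe_mul, ← rename_rename, ← mul_sub, ← map_sub,
      hh, map_mul, map_sub, rename_X, rename_X]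
    ring
  | add s t hs ht =>
    obtain ⟨s', hs'⟩ := hs
    obtain ⟨t', ht'⟩ := ht
    refine ⟨s' + t', fun v => ?_⟩
    rw [map_add, map_add, map_add, mul_add, hs', ht']
    ring

theorem rename_Delta {n : ℕ} (w : Perm (Fin n)) :
    rename w (Delta w) = ∏ p ∈ inv w, (X (w p.1) - X (w p.2) : R n) := by
  simp [Delta, map_prod]

theorem rename_Delta_ne_zero {n : ℕ} (w : Perm (Fin n)) : rename w (Delta w) ≠ 0 := by
  rw [rename_Delta, Finset.prod_ne_zero_iff]
  exact fun p hp => X_sub_X_ne_zero (mem_inv.1 hp).2.ne'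

theorem rename_Delta_eq_mul {n : ℕ} {w : Perm (Fin n)} {i j : Fin n} (hij : (i : ℕ) + 1 = j)
    (hw : w j < w i) :
    rename w (Delta w) =
      (X (w i) - X (w j)) * rename (w * swap i j) (Delta (w * swap i j)) := by
  rw [rename_Delta, rename_Delta, inv_eq_insert hij hw,
    Finset.prod_insert (notMem_map_inv w hij), Finset.prod_map]
  rfl

/-- If `F_v t = 0` for all `v` shorter than `w`, then `F_w t` is a right multiple of `Δ_w`. -/
theorem rename_Delta_dvd_FAlg {n : ℕ} (w : Perm (Fin n)) (t : T n)
    (ht : ∀ v : Perm (Fin n), length v < length w → FAlg v t = 0) :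
    rename w (Delta w) ∣ FAlg w t := by
  -- Coprimality is stated for increasing pairs, so an inversion (p, q) enters as (w q, w p); the
  -- signs do not affect divisibility.
  have h := prod_X_sub_X_dvd (f := FAlg w t)
    ((inv w).map ((prodComm _ _).trans (w.prodCongr w)).toEmbedding) ?_ ?_
  · rw [Finset.prod_map] at h
    rw [rename_Delta]
    refine dvd_trans ?_ h
    refine Finset.prod_dvd_prod_of_dvd _ _ fun p _ => ?_
    rw [← neg_dvd, neg_sub]
    rfl
  · intro p hp
    obtain ⟨q, hq, rfl⟩ := Finset.mem_map.1 hp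
    exact (mem_inv.1 hq).2
  · intro p hp
    obtain ⟨q, hq, rfl⟩ := Finset.mem_map.1 hp
    have h := X_sub_X_dvd_FAlg_sub w (w q.2) (w q.1) t
    rw [ht (swap (w q.2) (w q.1) * w), sub_zero] at h
    · exact h
    · rw [swap_comm, ← mul_swap_eq_swap_mul]
      exact length_mul_swap_lt (mem_inv.1 hq).1 (mem_inv.1 hq).2

/-! ### A dual family -/

/-- The element `∏_{i<j} (1 ⊗ x_i - x_{n+1-j} ⊗ 1)`; only `F_{w₀}` does not kill it. -/
def topElement (n : ℕ) : T n :=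
  ∏ p ∈ Finset.univ.filter (fun p : Fin n × Fin n => p.1 < p.2),
    (T.tmul 1 (X p.1) - T.tmul (X p.2.rev) 1)

theorem FAlg_topElement {n : ℕ} (v : Perm (Fin n)) :
    FAlg v (topElement n) = ∏ p ∈ Finset.univ.filter (fun p : Fin n × Fin n => p.1 < p.2),
      (X (v p.1) - X p.2.rev) := by
  simp only [topElement, map_prod, map_sub, FAlg_tmul, rename_X, map_one, mul_one, one_mul]

theorem FAlg_rev_topElement (n : ℕ) :
    FAlg Fin.revPerm (topElement n) = rename Fin.revPerm (Delta Fin.revPerm) := by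
  rw [FAlg_topElement, rename_Delta]
  refine Finset.prod_congr ?_ fun p _ => rfl
  ext p
  simp [mem_inv]

theorem eq_one_of_forall_le {n : ℕ} (σ : Perm (Fin n)) (h : ∀ i, σ i ≤ i) : σ = 1 := by
  ext i
  induction i using WellFoundedLT.induction with
  | ind i ih =>
    by_contra hne
    have hlt : σ i < i := lt_of_le_of_ne (h i) fun e => hne (by simp [e])
    have := Fin.ext (ih _ hlt)
    exact hlt.ne (σ.injective this)

/-- A nonzero product means v(i) ≠ rev(j) whenever i < j, that is rev(v(i)) ≤ i for all i, which
forces rev ∘ v = 1. -/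
theorem FAlg_topElement_eq_zero {n : ℕ} {v : Perm (Fin n)} (hv : v ≠ Fin.revPerm) :
    FAlg v (topElement n) = 0 := by
  rw [FAlg_topElement, Finset.prod_eq_zero_iff]
  by_contra! h
  refine hv ?_
  have : Fin.revPerm * v = 1 := eq_one_of_forall_le _ fun i => by
    by_contra! hlt
    refine h (i, (v i).rev) (by simpa using hlt) (by simp)
  rw [← mul_left_cancel_iff (a := Fin.revPerm), this]
  ext
  simp

theorem exists_FAlg_eq_rename_Delta {n : ℕ} (w : Perm (Fin n)) :
    ∃ t : T n, FAlg w t = rename w (Delta w) ∧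
      ∀ v : Perm (Fin n), v ≠ w → length v ≤ length w → FAlg v t = 0 := by
  -- Descending induction on length; `length_le_choose` keeps the truncated subtraction strictly
  -- decreasing.
  induction h : n.choose 2 - length w using Nat.strong_induction_on generalizing w with
  | _ k ih =>
    by_cases hw : w = Fin.revPerm
    · subst hw
      exact ⟨topElement n, FAlg_rev_topElement n, fun v hv _ => FAlg_topElement_eq_zero hv⟩
    · obtain ⟨i, j, hij, hlt⟩ := exists_lt_succ_of_ne_rev hw
      have hij' : i < j := by rw [Fin.lt_def]; omega
      have hinv : (w * swap i j) j < (w * swap i j) i := by simpa using hlt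
      have hss : w * swap i j * swap i j = w := by simp [mul_assoc]
      have hlen : length w < length (w * swap i j) := by
        simpa only [hss] using length_mul_swap_lt hij' hinv
      have hle := length_le_choose (w * swap i j)
      obtain ⟨t, ht1, ht2⟩ := ih _ (by omega) (w * swap i j) rfl
      obtain ⟨t', ht'⟩ := exists_divided_difference i j t
      have key (v : Perm (Fin n)) : (X (v i) - X (v j) : R n) ≠ 0 :=
        X_sub_X_ne_zero fun e => hij'.ne (v.injective e)
      refine ⟨t', ?_, fun v hv hvl => ?_⟩
      · have h0 : FAlg w t = 0 := ht2 w (fun e => by rw [← e] at hlen; exact lt_irrefl _ hlen)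
          hlen.le
        apply mul_left_cancel₀ (key w)
        rw [ht', h0, ht1, rename_Delta_eq_mul hij hinv, hss]
        simp only [Perm.coe_mul, Function.comp_apply, swap_apply_left, swap_apply_right]
        ring
      -- With s = (i j), neither v nor vs equals ws, and both have length at most ℓ(w) + 1 ≤ ℓ(ws),
      -- so `t` is killed by F_v and F_{vs}.
      · apply mul_left_cancel₀ (key v)
        rw [ht', ht2 v (fun e => by rw [e] at hvl; omega) (by omega),
          ht2 (v * swap i j) (fun e => hv (mul_right_cancel e))
            ((length_mul_swap_le v hij).trans (by omega))]
        simp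

/-! ### Joint injectivity of the maps `F_w` -/

/-- The Vandermonde product `∏_{i<j} (x_j - x_i)`. -/
def vand (n : ℕ) : R n := (Matrix.vandermonde (X : Fin n → R n)).det

theorem vand_ne_zero (n : ℕ) : vand n ≠ 0 :=
  Matrix.det_vandermonde_ne_zero_iff.2 X_injective

theorem vand_eq_prod (n : ℕ) :
    vand n = ∏ p ∈ Finset.univ.filter (fun p : Fin n × Fin n => p.1 < p.2),
      (X p.2 - X p.1) := by
  rw [vand, Matrix.det_vandermonde, Finset.prod_filter, Fintype.prod_prod_type]
  refine Finset.prod_congr rfl fun i _ => ?_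
  rw [← Finset.prod_filter]
  refine Finset.prod_congr ?_ fun _ _ => rfl
  ext j
  simp

theorem rename_vand {n : ℕ} (w : Perm (Fin n)) :
    rename w (vand n) = (Perm.sign w : ℤ) • vand n := by
  have h : (rename w : R n →ₐ[ℂ] R n).mapMatrix (Matrix.vandermonde (X : Fin n → R n)) =
      (Matrix.vandermonde (X : Fin n → R n)).submatrix w id := by
    ext i j
    simp [Matrix.vandermonde_apply]
  rw [vand, AlgHom.map_det, h, Matrix.det_permute, zsmul_eq_mul]

theorem FAlg_rev_topElement_eq_vand (n : ℕ) : FAlg Fin.revPerm (topElement n) = vand n := by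
  rw [FAlg_topElement, vand_eq_prod]
  refine Finset.prod_nbij' (fun p => (p.2.rev, p.1.rev)) (fun p => (p.2.rev, p.1.rev))
    ?_ ?_ ?_ ?_ ?_ <;> simp

theorem rename_sum_sign {n : ℕ} (v : Perm (Fin n)) (h : R n) :
    rename v (∑ w : Perm (Fin n), (Perm.sign w : ℤ) • rename w h) =
      (Perm.sign v : ℤ) • ∑ w : Perm (Fin n), (Perm.sign w : ℤ) • rename w h := by
  rw [map_sum, Finset.smul_sum]
  refine Fintype.sum_equiv (Equiv.mulLeft v) _ _ fun w => ?_
  rw [map_zsmul, rename_rename, Equiv.coe_mulLeft, Perm.sign_mul, smul_smul, Units.val_mul,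
    ← mul_assoc, ← Units.val_mul, Int.units_mul_self, Units.val_one, one_mul]
  rfl

/-- The sum A is antisymmetric, so each x_i - x_j divides A - (i j)A = 2A, and 2 is a unit. -/
theorem vand_dvd_sum_sign {n : ℕ} (h : R n) :
    vand n ∣ ∑ w : Perm (Fin n), (Perm.sign w : ℤ) • rename w h := by
  have key := prod_X_sub_X_dvd (f := ∑ w : Perm (Fin n), (Perm.sign w : ℤ) • rename w h)
    (Finset.univ.filter (fun p : Fin n × Fin n => p.1 < p.2)) (by simp) fun p hp => by
      have h1 := X_sub_X_dvd_sub_rename_swap p.1 p.2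
        (∑ w : Perm (Fin n), (Perm.sign w : ℤ) • rename w h)
      rw [rename_sum_sign, Perm.sign_swap (Finset.mem_filter.1 hp).2.ne] at h1
      simp only [Units.val_neg, Units.val_one, neg_smul, one_smul, sub_neg_eq_add] at h1
      rw [← two_mul] at h1
      refine (IsUnit.dvd_mul_left ?_).1 h1
      have : IsUnit (C (2 : ℂ) : R n) := (isUnit_iff_ne_zero.2 two_ne_zero).map C
      rwa [map_ofNat] at this
  refine dvd_trans ?_ key
  rw [vand_eq_prod]
  refine Finset.prod_dvd_prod_of_dvd _ _ fun p _ => ?_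
  rw [← neg_dvd, neg_sub]

/-- The antisymmetrization of a polynomial, divided by the Vandermonde product, is symmetric. -/
theorem exists_symmetric_mul_vand {n : ℕ} (h : R n) :
    ∃ d : RSym n, vand n * d = ∑ w : Perm (Fin n), (Perm.sign w : ℤ) • rename w h := by
  obtain ⟨d, hd⟩ := vand_dvd_sum_sign h
  refine ⟨⟨d, fun v => ?_⟩, hd.symm⟩
  have h1 := rename_sum_sign v h
  rw [hd, map_mul, rename_vand, smul_mul_assoc] at h1
  have h2 := congrArg (fun f => (Perm.sign v : ℤ) • f) h1
  simp only [smul_smul, ← Units.val_mul, Int.units_mul_self, Units.val_one, one_smul] at h2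
  exact mul_left_cancel₀ (vand_ne_zero n) h2

theorem eq_zero_of_forall_FAlg_eq_zero {n : ℕ} (t : T n)
    (ht : ∀ w : Perm (Fin n), FAlg w t = 0) : t = 0 := by
  choose D hD using exists_symmetric_mul_vand (n := n)
  obtain ⟨m, a, b, hab⟩ := T.exists_sum_tmul (topElement n)
  obtain ⟨k, f, g, hfg⟩ := T.exists_sum_tmul t
  -- The signed sum of F_w(`topElement`)·w(h) has only its w₀ term; expanding `topElement` instead
  -- yields antisymmetrizations of the b_l h.
  have dual (h : R n) :
      (Perm.sign (Fin.revPerm : Perm (Fin n)) : ℤ) • rename Fin.revPerm h =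
        ∑ l, a l * D (b l * h) := by
    apply mul_left_cancel₀ (vand_ne_zero n)
    calc vand n * ((Perm.sign (Fin.revPerm : Perm (Fin n)) : ℤ) • rename Fin.revPerm h)
        = ∑ w : Perm (Fin n), (Perm.sign w : ℤ) • (FAlg w (topElement n) * rename w h) := by
          rw [Finset.sum_eq_single Fin.revPerm, FAlg_rev_topElement_eq_vand, mul_smul_comm]
          · intro w _ hw
            rw [FAlg_topElement_eq_zero hw, zero_mul, smul_zero]
          · simp
      _ = ∑ w : Perm (Fin n), ∑ l, a l * ((Perm.sign w : ℤ) • rename w (b l * h)) := by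
          refine Finset.sum_congr rfl fun w _ => ?_
          rw [hab, map_sum, Finset.sum_mul, Finset.smul_sum]
          refine Finset.sum_congr rfl fun l _ => ?_
          rw [FAlg_tmul, map_mul, mul_smul_comm, mul_assoc]
      _ = vand n * ∑ l, a l * D (b l * h) := by
          rw [Finset.sum_comm, Finset.mul_sum]
          refine Finset.sum_congr rfl fun l _ => ?_
          rw [← Finset.mul_sum, ← hD, mul_left_comm]
  let c (l : Fin m) : R n :=
    (Perm.sign (Fin.revPerm : Perm (Fin n)) : ℤ) • rename Fin.revPerm (a l)
  -- Apply sign(w₀)·w₀ to `dual`; the values of `D` are symmetric, hence unchanged.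
  have expand (h : R n) : h = ∑ l, D (b l * h) • c l := by
    have hrev : rename Fin.revPerm (rename Fin.revPerm h) = h := by
      rw [rename_rename]
      convert rename_id_apply h
      ext; simp
    have h1 := congrArg (fun p => (Perm.sign (Fin.revPerm : Perm (Fin n)) : ℤ) •
      rename Fin.revPerm p) (dual h)
    simp only [map_zsmul, hrev, smul_smul, ← Units.val_mul, Int.units_mul_self, Units.val_one,
      one_smul, map_sum, map_mul, Finset.smul_sum] at h1
    rw [h1]
    refine Finset.sum_congr rfl fun l _ => ?_
    rw [(D (b l * h)).2 Fin.revPerm, Subalgebra.smul_def, smul_eq_mul, ← h1, mul_comm,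
      mul_smul_comm, mul_comm]
  have coef (l : Fin m) : ∑ i, f i * D (b l * g i) = 0 := by
    apply mul_left_cancel₀ (vand_ne_zero n)
    calc vand n * ∑ i, f i * D (b l * g i)
        = ∑ w : Perm (Fin n), (Perm.sign w : ℤ) • (rename w (b l) * FAlg w t) := by
          rw [Finset.mul_sum]
          simp_rw [mul_left_comm (vand n), hD, Finset.mul_sum]
          rw [Finset.sum_comm]
          refine Finset.sum_congr rfl fun w _ => ?_
          rw [hfg, map_sum, Finset.mul_sum, Finset.smul_sum]
          refine Finset.sum_congr rfl fun i _ => ?_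
          rw [FAlg_tmul, map_mul, mul_smul_comm, mul_left_comm]
      _ = vand n * 0 := by simp [ht]
  calc t = ∑ i, ∑ l, (T.tmul (f i * (D (b l * g i) : R n)) (c l) : T n) := by
        rw [hfg]
        refine Finset.sum_congr rfl fun i _ => ?_
        conv_lhs => rw [expand (g i)]
        refine (TensorProduct.tmul_sum (R := RSym n) _ _ _).trans ?_
        refine Finset.sum_congr rfl fun l _ => ?_
        refine (TensorProduct.smul_tmul (R := RSym n) _ _ _).symm.trans ?_
        rw [Subalgebra.smul_def, smul_eq_mul, mul_comm]
        rfl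
    _ = ∑ l, T.tmul (∑ i, f i * (D (b l * g i) : R n)) (c l) := by
        rw [Finset.sum_comm]
        refine Finset.sum_congr rfl fun l _ => ?_
        exact (TensorProduct.sum_tmul (R := RSym n) _ _ _).symm
    _ = 0 := by
        refine Finset.sum_eq_zero fun l _ => ?_
        rw [coef]
        exact TensorProduct.zero_tmul _ _

/-! ### The filtration -/

theorem mem_rightMul {n : ℕ} {w : Perm (Fin n)} {g : R n} {x : RTw w} :
    x ∈ rightMul w g ↔ rename w g ∣ (x : R n) := by
  constructor
  · rintro ⟨y, rfl⟩
    refine ⟨y, ?_⟩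
    change envToR w (Env.tmul 1 g) * (show R n from y) = _
    rw [envToR_tmul, one_mul]
  · rintro ⟨y, hy⟩
    refine ⟨y, ?_⟩
    change envToR w (Env.tmul 1 g) * y = x
    rw [envToR_tmul, one_mul]
    exact hy.symm

theorem lsmul_injective {n : ℕ} {w : Perm (Fin n)} {a : Env n} (ha : envToR w a ≠ 0) :
    Function.Injective (LinearMap.lsmul (Env n) (RTw w) a) := fun _ _ h =>
  mul_left_cancel₀ (M₀ := R n) ha h

/-- Both the right and the left multiples of `Δ_w` form a bimodule isomorphic to `R_w`. -/
def rightMulEquivLeftMul {n : ℕ} (w : Perm (Fin n)) :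
    rightMul w (Delta w) ≃ₗ[Env n] leftMul w (Delta w) :=
  (LinearEquiv.ofInjective _ (lsmul_injective (a := Env.tmul 1 (Delta w)) (by
    rw [envToR_tmul, one_mul]; exact rename_Delta_ne_zero w))).symm.trans
  (LinearEquiv.ofInjective _ (lsmul_injective (a := Env.tmul (Delta w) 1) (by
    rw [envToR_tmul, map_one, mul_one]
    exact fun h => rename_Delta_ne_zero w (by rw [h, map_zero]))))

/-- `Γ_j`, the common kernel of the `F_v` with `ℓ(v) < j`. -/
def Gam (n j : ℕ) : Submodule (Env n) (T n) :=
  ⨅ (v : Perm (Fin n)) (_ : length v < j), LinearMap.ker (F v)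

theorem mem_Gam {n j : ℕ} {t : T n} :
    t ∈ Gam n j ↔ ∀ v : Perm (Fin n), length v < j → FAlg v t = 0 := by
  simp only [Gam, Submodule.mem_iInf, LinearMap.mem_ker]
  rfl

/-- The map `⨁_{ℓ(w)=j} F_w` on `Γ_j`. -/
def gamMap (n j : ℕ) : Gam n j →ₗ[Env n]
    ⨁ w : {w : Perm (Fin n) // length w = j}, rightMul w.1 (Delta w.1) :=
  (DirectSum.linearEquivFunOnFintype (Env n) {w : Perm (Fin n) // length w = j}
    (fun w => rightMul w.1 (Delta w.1))).symm.toLinearMap ∘ₗ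
  LinearMap.pi fun w => LinearMap.codRestrict (rightMul w.1 (Delta w.1))
    (F w.1 ∘ₗ (Gam n j).subtype) fun m => mem_rightMul.2
      (rename_Delta_dvd_FAlg w.1 m.1 fun v hv => mem_Gam.1 m.2 v (w.2 ▸ hv))

theorem gamMap_apply {n j : ℕ} (m : Gam n j) (w : {w : Perm (Fin n) // length w = j}) :
    (gamMap n j m w : RTw w.1) = F w.1 (m : T n) :=
  rfl

theorem ker_gamMap (n j : ℕ) :
    LinearMap.ker (gamMap n j) = (Gam n (j + 1)).submoduleOf (Gam n j) := by
  ext m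
  rw [LinearMap.mem_ker, Submodule.submoduleOf, Submodule.mem_comap, mem_Gam]
  constructor
  · intro h v hv
    rcases Nat.lt_succ_iff_lt_or_eq.1 hv with hv | hv
    · exact mem_Gam.1 m.2 v hv
    · have := gamMap_apply m ⟨v, hv⟩
      rw [h] at this
      exact this.symm
  · intro h
    refine DFinsupp.ext fun w => Subtype.ext ?_
    exact (gamMap_apply m w).trans (h w.1 (by omega))

theorem gamMap_surjective (n j : ℕ) : Function.Surjective (gamMap n j) := by
  intro y
  choose d hd0 hd using exists_FAlg_eq_rename_Delta (n := n)
  have hy (w : {w : Perm (Fin n) // length w = j}) :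
      ∃ h : R n, (y w : RTw w.1) = (h * rename w.1 (Delta w.1) : R n) := by
    obtain ⟨h, hh⟩ := mem_rightMul.1 (y w).2
    exact ⟨h, by rw [mul_comm]; exact hh⟩
  choose h hh using hy
  have hF (v : Perm (Fin n)) : FAlg v (∑ w, T.tmul (h w) 1 * d w.1) =
      ∑ w, h w * FAlg v (d w.1) := by
    simp [FAlg_tmul]
  -- Among elements of length at most j, F_v kills every `d w` except the one with w = v.
  refine ⟨⟨∑ w, T.tmul (h w) 1 * d w.1, mem_Gam.2 fun v hv => ?_⟩, ?_⟩
  · rw [hF]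
    refine Finset.sum_eq_zero fun w _ => ?_
    have := w.2
    rw [hd w.1 v (by rintro rfl; omega) (by omega), mul_zero]
  · refine DFinsupp.ext fun v => Subtype.ext ?_
    refine (gamMap_apply _ v).trans ((hF v.1).trans ?_)
    rw [hh v, Finset.sum_eq_single v, hd0]
    · intro w _ hw
      rw [hd w.1 v.1 (fun e => hw (Subtype.ext e.symm)) (by rw [w.2, v.2]), mul_zero]
    · simp

end

end GammaFiltration

theorem mainTheorem8 (n : ℕ) :
    ∃ Γ : ℕ → Submodule (GammaFiltration.Env n) (GammaFiltration.T n),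
      Γ 0 = ⊤ ∧
      Γ (n.choose 2 + 1) = ⊥ ∧
      ∀ j ≤ n.choose 2,
        Γ (j + 1) ≤ Γ j ∧
        (∃ e : GammaFiltration.Gr (Γ j) (Γ (j + 1)) ≃ₗ[GammaFiltration.Env n]
            ⨁ w : {w : Equiv.Perm (Fin n) // GammaFiltration.length w = j},
              GammaFiltration.rightMul w.1 (GammaFiltration.Delta w.1),
          ∀ (m : Γ j) (w : {w : Equiv.Perm (Fin n) // GammaFiltration.length w = j}),
            ((e (Submodule.Quotient.mk m) w : GammaFiltration.rightMul w.1
              (GammaFiltration.Delta w.1)) : GammaFiltration.RTw w.1) =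
              GammaFiltration.F w.1 (m : GammaFiltration.T n)) ∧
        Nonempty (GammaFiltration.Gr (Γ j) (Γ (j + 1)) ≃ₗ[GammaFiltration.Env n]
            ⨁ w : {w : Equiv.Perm (Fin n) // GammaFiltration.length w = j},
              GammaFiltration.leftMul w.1 (GammaFiltration.Delta w.1)) := by
  open GammaFiltration in
  refine ⟨Gam n, ?_, ?_, fun j _ => ⟨?_, ?_⟩⟩
  · exact eq_top_iff.2 fun t _ => mem_Gam.2 fun v hv => absurd hv (Nat.not_lt_zero _)
  · exact eq_bot_iff.2 fun t ht => eq_zero_of_forall_FAlg_eq_zero t fun w =>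
      mem_Gam.1 ht w (Nat.lt_succ_of_le (length_le_choose w))
  · exact fun t ht => mem_Gam.2 fun v hv => mem_Gam.1 ht v (Nat.lt_succ_of_lt hv)
  · let e := (Submodule.quotEquivOfEq _ _ (ker_gamMap n j).symm).trans
      ((gamMap n j).quotKerEquivOfSurjective (gamMap_surjective n j))
    exact ⟨⟨e, fun m w => gamMap_apply m w⟩,
      ⟨e.trans (DFinsupp.mapRange.linearEquiv fun w => rightMulEquivLeftMul w.1)⟩⟩
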